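/- Let $n,d$ be natural numbers, $x^*\in\mathbb{R}^d$ and $\sigma>0$. Consider the observations $y=\Pi^*Ax^*+w$, where $\Pi^*$ is an $n\times n$ permutation matrix, $A\in\mathbb{R}^{n\times d}$ has i.i.d. standard Gaussian entries, and $w\sim\mathcal{N}(0,\sigma^2I_n)$ is independent of $A$. An estimator is a measurable map $(y,A)\mapsto\widehat\Pi(y,A)$ into the set $\mathcal{P}_n$ of $n\times n$ permutation matrices; it is allowed to depend on the parameters $n,d,x^*,\sigma$. For $\Pi\in\mathcal{P}_n$ let $\Pr_\Pi\{\widehat\Pi\neq\Pi\}$ be the probability of error, over $A$ and $w$, when $\Pi^*=\Pi$. There are absolute constants $c_3,c_4>0$ such that for all $n,d,x^*,\sigma$ as above and all $\delta\in(0,2)$: if $$2+\log\Bigl(1+\frac{\|x^*\|_2^2}{\sigma^2}\Bigr)\le(2-\delta)\log n,$$ then every estimator $\widehat\Pi$, even one that knows $x^*$, satisfies $$\frac1{n!}\sum_{\Pi\in\mathcal{P}_n}\Pr\nolimits_\Pi\{\widehat\Pi\neq\Pi\}\ \ge\ 1-c_3e^{-c_4n\delta}.$$ That is, it errs with probability at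 least $1-c_3e^{-c_4n\delta}$ when $\Pi^*$ is uniformly distributed on $\mathcal{P}_n$, independently of $(A,w)$. Consequently, for every estimator there is a $\Pi^*\in\mathcal{P}_n$ such that $\Pr_{\Pi^*}\{\widehat\Pi\neq\Pi^*\}\ge1-c_3e^{-c_4n\delta}$. -/

import Mathlib

open MeasureTheory ProbabilityTheory
open scoped NNReal Matrix

namespace UnknownPermutation

noncomputable section

/-- The law of an `n × d` design matrix `A`, given by its entries `A i j`, which are i.i.d. standard
Gaussian. -/
def designLaw (n d : ℕ) : Measure (Fin n → Fin d → ℝ) :=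
  Measure.pi fun _ : Fin n => Measure.pi fun _ : Fin d => gaussianReal 0 1

/-- The law `N(0, σ² Iₙ)` of the noise vector: i.i.d. centred Gaussian entries of variance `σ²`. -/
def noiseLaw (n : ℕ) (σ : ℝ) : Measure (Fin n → ℝ) :=
  Measure.pi fun _ : Fin n => gaussianReal 0 (Real.toNNReal (σ ^ 2))

/-- The observation `y = Π A x + w`, where `Π` is the permutation matrix of `π`. -/
def observation {n d : ℕ} (x : EuclideanSpace ℝ (Fin d)) (π : Equiv.Perm (Fin n))
    (A : Fin n → Fin d → ℝ) (w : Fin n → ℝ) : Fin n → ℝ :=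
  π.permMatrix ℝ *ᵥ (Matrix.of A *ᵥ x.ofLp) + w

/-- A (deterministic) estimator: a measurable map `(y, A) ↦ Π̂(y, A)` with values in the
permutations of `n` objects (a finite set, with its discrete σ-algebra). -/
def IsEstimator {n d : ℕ}
    (est : (Fin n → ℝ) × (Fin n → Fin d → ℝ) → Equiv.Perm (Fin n)) : Prop :=
  ∀ π : Equiv.Perm (Fin n), MeasurableSet (est ⁻¹' {π})

/-- `Pr {Π̂ ≠ Π*}` when the true signal is `x`, the true permutation is `π` and the noise level is
`σ`; the probability is over the independent design `A` and noise `w`. -/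
def errorProb {n d : ℕ} (x : EuclideanSpace ℝ (Fin d)) (σ : ℝ)
    (est : (Fin n → ℝ) × (Fin n → Fin d → ℝ) → Equiv.Perm (Fin n))
    (π : Equiv.Perm (Fin n)) : ℝ :=
  ((designLaw n d).prod (noiseLaw n σ)).real
    {p | est (observation x π p.1 p.2, p.1) ≠ π}

/-- The error probability averaged over a uniformly random true permutation that is independent of
the design and of the noise. -/
def averageErrorProb {n d : ℕ} (x : EuclideanSpace ℝ (Fin d)) (σ : ℝ)
    (est : (Fin n → ℝ) × (Fin n → Fin d → ℝ) → Equiv.Perm (Fin n)) : ℝ :=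
  (∑ π : Equiv.Perm (Fin n), errorProb x σ est π) / (n.factorial : ℝ)

end

end UnknownPermutation

/-!
At these signal-to-noise ratios the error has a local cause. The condition forces `‖x‖ ≤ n σ`, so
that the `n` signal values `z i = (A x) i`, which are Gaussian of standard deviation `‖x‖`, lie
mostly in an interval of length `O(n σ)`. By the pigeonhole principle, linearly many disjoint pairs
of them are at distance `O(σ)`, and the noise at most indices is `O(σ)` as well. Exchanging the two
values of such a pair changes the likelihood of the observation only by a bounded factor, so the
`2 ^ k` products of `k` such transpositions give permutations whose likelihoods add up to at least
`(1 + c) ^ k` times that of the true one (`exists_perms_weight_ge`, `likelihood_le_sum_likelihood`).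

An estimator can therefore succeed only rarely. On the event of success at `π`, with typical `z` and
`w`, the density of `y` under `π` is at most `(1 + c) ^ (-k)` times the sum of the densities under
all permutations. These events, as sets of `y`, are disjoint for different `π`, so summing over `π`
gives at most `(1 + c) ^ (-k) n !` (`sum_noiseLaw_success_le`). The exceptional `z` and `w` are
those with a large `ℓ¹` norm, and Chernoff's bound (`measure_sum_abs_gt_le`) makes their probability
at most `2 exp (-n)`. The resulting bound is exponentially small in `n`, uniformly in `δ`, which is
more than needed.
-/

namespace UnknownPermutation

open scoped ENNReal

/-! ### Many permutations of comparable weight -/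

/-- Right multiplication by a transposition of two fixed points of `h` multiplies the weight
`∏ i, u i (h i)` by at least `c`, when this is so for the identity. -/
lemma mul_prod_le_prod_mul_swap {ι : Type*} [Fintype ι] [DecidableEq ι] (u : ι → ι → ℝ≥0∞)
    {c : ℝ≥0∞} {a b : ι} (hab : a ≠ b) (hc : c * (u a a * u b b) ≤ u a b * u b a)
    {h : Equiv.Perm ι} (ha : h a = a) (hb : h b = b) :
    c * ∏ i, u i (h i) ≤ ∏ i, u i ((h * Equiv.swap a b) i) := by
  have split (f : ι → ℝ≥0∞) : ∏ i, f i = f a * f b * ∏ i ∈ (Finset.univ.erase a).erase b, f i := by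
    rw [mul_assoc, Finset.mul_prod_erase _ _ (by simp [hab.symm]),
      Finset.mul_prod_erase _ _ (Finset.mem_univ a)]
  rw [split, split (fun i => u i ((h * Equiv.swap a b) i))]
  simp only [Equiv.Perm.mul_apply, Equiv.swap_apply_left, Equiv.swap_apply_right, ha, hb]
  rw [← mul_assoc]
  refine mul_le_mul' hc (Finset.prod_le_prod' fun i hi => ?_)
  simp only [Finset.mem_erase, Finset.mem_univ, and_true] at hi
  rw [Equiv.swap_apply_of_ne_of_ne hi.2 hi.1]

/-- If the points of `G` are put into the buckets `t`, and exchanging two points of one bucket costs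
at most a factor `c` in weight, then the permutations moving only points of `G` have total weight at
least `(1 + c) ^ k` times that of the identity, where `k` is about half of `#G - #t`. By the
pigeonhole principle there are `k` disjoint pairs of points in common buckets, and the weights of
the `2 ^ k` products of the corresponding transpositions add up to at least this. -/
lemma exists_perms_weight_ge {ι τ : Type*} [Fintype ι] [DecidableEq ι]
    (u : ι → ι → ℝ≥0∞) (c : ℝ≥0∞) (bucket : ι → τ) (t : Finset τ) (G : Finset ι)
    (hmaps : ∀ i ∈ G, bucket i ∈ t)
    (hc : ∀ a ∈ G, ∀ b ∈ G, a ≠ b → bucket a = bucket b → c * (u a a * u b b) ≤ u a b * u b a) :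
    ∃ S : Finset (Equiv.Perm ι), (∀ h ∈ S, ∀ i ∉ G, h i = i) ∧
      (1 + c) ^ ((G.card - t.card) / 2) * ∏ i, u i i ≤ ∑ h ∈ S, ∏ i, u i (h i) := by
  induction hn : G.card using Nat.strong_induction_on generalizing G with
  | _ n ih =>
  subst hn
  by_cases hlt : t.card < G.card
  · obtain ⟨a, ha, b, hb, hab, hbk⟩ := Finset.exists_ne_map_eq_of_card_lt_of_maps_to hlt hmaps
    have hbG : b ∈ G.erase a := by simp [hab.symm, hb]
    have hcard : ((G.erase a).erase b).card = G.card - 2 := by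
      rw [Finset.card_erase_of_mem hbG, Finset.card_erase_of_mem ha]; omega
    have hpos : 0 < G.card := by omega
    obtain ⟨S, hS, hsum⟩ := ih _ (by omega) ((G.erase a).erase b)
      (fun i hi => hmaps i (Finset.mem_of_mem_erase (Finset.mem_of_mem_erase hi)))
      (fun i hi j hj => hc i (Finset.mem_of_mem_erase (Finset.mem_of_mem_erase hi))
        j (Finset.mem_of_mem_erase (Finset.mem_of_mem_erase hj))) rfl
    have hfa : ∀ h ∈ S, h a = a := fun h hh => hS h hh a (by simp)
    have hfb : ∀ h ∈ S, h b = b := fun h hh => hS h hh b (by simp)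
    have hinj : Function.Injective (fun h : Equiv.Perm ι => h * Equiv.swap a b) :=
      mul_left_injective _
    have hdisj : Disjoint S (S.image fun h => h * Equiv.swap a b) := by
      rw [Finset.disjoint_left]
      intro h hh hh'
      obtain ⟨g, hg, rfl⟩ := Finset.mem_image.1 hh'
      have h1 := hfa _ hh
      simp only [Equiv.Perm.mul_apply, Equiv.swap_apply_left, hfb g hg] at h1
      exact hab h1.symm
    refine ⟨S ∪ S.image fun h => h * Equiv.swap a b, ?_, ?_⟩
    · intro h hh i hi
      have hia : i ≠ a := fun e => hi (e ▸ ha)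
      have hib : i ≠ b := fun e => hi (e ▸ hb)
      rcases Finset.mem_union.1 hh with hh | hh
      · exact hS h hh i (by simp [hi])
      · obtain ⟨g, hg, rfl⟩ := Finset.mem_image.1 hh
        rw [Equiv.Perm.mul_apply, Equiv.swap_apply_of_ne_of_ne hia hib]
        exact hS g hg i (by simp [hi])
    · rw [Finset.sum_union hdisj, Finset.sum_image hinj.injOn]
      calc (1 + c) ^ ((G.card - t.card) / 2) * ∏ i, u i i
          ≤ (1 + c) ^ ((((G.erase a).erase b).card - t.card) / 2 + 1) * ∏ i, u i i := by
            gcongr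
            · exact le_self_add
            · omega
        _ = (1 + c) * ((1 + c) ^ ((((G.erase a).erase b).card - t.card) / 2) * ∏ i, u i i) := by
            ring
        _ ≤ (1 + c) * ∑ h ∈ S, ∏ i, u i (h i) := by gcongr
        _ = ∑ h ∈ S, ∏ i, u i (h i) + ∑ h ∈ S, c * ∏ i, u i (h i) := by
            rw [add_mul, one_mul, Finset.mul_sum]
        _ ≤ _ := by
            gcongr with h hh
            exact mul_prod_le_prod_mul_swap u hab (hc a ha b hb hab hbk) (hfa h hh) (hfb h hh)
  · refine ⟨{1}, by simp, ?_⟩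
    have : G.card - t.card = 0 := by omega
    simp [this]

/-! ### Products of measures -/

lemma lintegral_pi_prod_eq_prod {n : ℕ} {E : Type*} [MeasurableSpace E]
    (μ : Fin n → Measure E) [∀ i, SigmaFinite (μ i)] {f : Fin n → E → ℝ≥0∞}
    (hf : ∀ i, Measurable (f i)) :
    ∫⁻ x, ∏ i, f i (x i) ∂Measure.pi μ = ∏ i, ∫⁻ x, f i x ∂μ i := by
  induction n with
  | zero => simp
  | succ n ih =>
    have hmeas : Measurable fun y : Fin n → E => ∏ i : Fin n, f i.succ (y i) := by fun_prop
    rw [← ((measurePreserving_piFinSuccAbove μ 0).symm).lintegral_comp_emb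
      (MeasurableEquiv.measurableEmbedding _), Fin.prod_univ_succ,
      ← ih (fun i => μ i.succ) fun i => hf i.succ,
      ← lintegral_prod_mul (hf 0).aemeasurable hmeas.aemeasurable]
    simp [Fin.prod_univ_succ, MeasurableEquiv.piFinSuccAbove_symm_apply, Fin.insertNthEquiv]

lemma pi_withDensity_eq_withDensity_prod {n : ℕ} {p : ℝ → ℝ≥0∞} (hp : Measurable p)
    [SigmaFinite ((volume : Measure ℝ).withDensity p)] :
    Measure.pi (fun _ : Fin n => (volume : Measure ℝ).withDensity p) =
      (volume : Measure (Fin n → ℝ)).withDensity fun w => ∏ i, p (w i) := by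
  refine Measure.pi_eq fun s hs => ?_
  rw [withDensity_apply _ (MeasurableSet.univ_pi hs),
    ← lintegral_indicator (MeasurableSet.univ_pi hs), volume_pi]
  have h (w : Fin n → ℝ) : (Set.univ.pi s).indicator (fun w => ∏ i, p (w i)) w =
      ∏ i, (s i).indicator p (w i) := by
    by_cases hw : w ∈ Set.univ.pi s
    · rw [Set.indicator_of_mem hw]
      exact Finset.prod_congr rfl fun i _ => (Set.indicator_of_mem (hw i trivial) _).symm
    · rw [Set.indicator_of_notMem hw]
      simp only [Set.mem_pi, Set.mem_univ, true_implies, not_forall] at hw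
      obtain ⟨i, hi⟩ := hw
      exact (Finset.prod_eq_zero (Finset.mem_univ i) (Set.indicator_of_notMem hi _)).symm
  simp_rw [h]
  rw [lintegral_pi_prod_eq_prod _ fun i => hp.indicator (hs i)]
  exact Finset.prod_congr rfl fun i _ => by
    rw [withDensity_apply _ (hs i), lintegral_indicator (hs i)]

lemma noiseLaw_eq_withDensity (n : ℕ) {σ : ℝ} (hσ : 0 < σ) :
    noiseLaw n σ = (volume : Measure (Fin n → ℝ)).withDensity
      fun w => ∏ i, gaussianPDF 0 (Real.toNNReal (σ ^ 2)) (w i) := by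
  have hv : Real.toNNReal (σ ^ 2) ≠ 0 := by simp; positivity
  have hd := gaussianReal_of_var_ne_zero 0 hv
  have : SigmaFinite
      ((volume : Measure ℝ).withDensity (gaussianPDF 0 (Real.toNNReal (σ ^ 2)))) := by
    rw [← hd]; infer_instance
  rw [noiseLaw, hd, pi_withDensity_eq_withDensity_prod (measurable_gaussianPDF _ _)]

/-! ### Concentration of the signal and of the noise -/

lemma lintegral_exp_mul_gaussianReal (v : ℝ≥0) (t : ℝ) :
    ∫⁻ x, ENNReal.ofReal (Real.exp (t * x)) ∂gaussianReal 0 v =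
      ENNReal.ofReal (Real.exp (v * t ^ 2 / 2)) := by
  rw [← ofReal_integral_eq_lintegral_ofReal (integrable_exp_mul_gaussianReal t)
    (ae_of_all _ fun _ => (Real.exp_pos _).le)]
  have := mgf_gaussianReal (p := gaussianReal 0 v) (X := id) Measure.map_id t
  simp only [mgf, id, zero_mul, zero_add] at this
  rw [this]

/-- Chernoff's bound for a sum of absolute values of i.i.d. variables whose moment generating
function at `±1 / r` is at most that of a Gaussian of variance `r ^ 2`. -/
lemma measure_sum_abs_gt_le {n : ℕ} {E : Type*} [MeasurableSpace E] (μ : Measure E)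
    [SigmaFinite μ] {f : E → ℝ} (hf : Measurable f) {r : ℝ} (hr : 0 < r)
    (hpos : ∫⁻ a, ENNReal.ofReal (Real.exp (r⁻¹ * f a)) ∂μ ≤ ENNReal.ofReal (Real.exp (1 / 2)))
    (hneg : ∫⁻ a, ENNReal.ofReal (Real.exp (-r⁻¹ * f a)) ∂μ ≤ ENNReal.ofReal (Real.exp (1 / 2))) :
    Measure.pi (fun _ : Fin n => μ) {a | 3 * n * r < ∑ i, |f (a i)|} ≤
      ENNReal.ofReal (Real.exp (-n)) := by
  set g : E → ℝ≥0∞ := fun a => ENNReal.ofReal (Real.exp (r⁻¹ * |f a| - 3)) with hg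
  have hgm : Measurable g := by fun_prop
  have hgint : ∫⁻ a, g a ∂μ ≤ ENNReal.ofReal (Real.exp (-1)) := by
    have hle (a : E) : g a ≤ ENNReal.ofReal (Real.exp (-3)) *
        (ENNReal.ofReal (Real.exp (r⁻¹ * f a)) + ENNReal.ofReal (Real.exp (-r⁻¹ * f a))) := by
      rw [← ENNReal.ofReal_add (Real.exp_pos _).le (Real.exp_pos _).le,
        ← ENNReal.ofReal_mul (Real.exp_pos _).le]
      refine ENNReal.ofReal_le_ofReal ?_
      rw [sub_eq_neg_add, Real.exp_add]
      gcongr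
      rcases abs_cases (f a) with ⟨h, _⟩ | ⟨h, _⟩ <;> rw [h]
      · linarith [Real.exp_pos (-r⁻¹ * f a)]
      · rw [mul_neg, ← neg_mul]
        linarith [Real.exp_pos (r⁻¹ * f a)]
    calc ∫⁻ a, g a ∂μ ≤ _ := lintegral_mono hle
      _ = ENNReal.ofReal (Real.exp (-3)) * (∫⁻ a, ENNReal.ofReal (Real.exp (r⁻¹ * f a)) ∂μ +
          ∫⁻ a, ENNReal.ofReal (Real.exp (-r⁻¹ * f a)) ∂μ) := by
        rw [lintegral_const_mul _ (by fun_prop), lintegral_add_left (by fun_prop)]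
      _ ≤ ENNReal.ofReal (Real.exp (-3)) *
          (ENNReal.ofReal (Real.exp (1 / 2)) + ENNReal.ofReal (Real.exp (1 / 2))) := by gcongr
      _ ≤ _ := by
        rw [← ENNReal.ofReal_add (Real.exp_pos _).le (Real.exp_pos _).le,
          ← ENNReal.ofReal_mul (Real.exp_pos _).le]
        refine ENNReal.ofReal_le_ofReal ?_
        have h2 : (2 : ℝ) ≤ Real.exp 1 := by linarith [Real.add_one_le_exp (1 : ℝ)]
        calc Real.exp (-3) * (Real.exp (1 / 2) + Real.exp (1 / 2))
            = Real.exp (-3) * (2 * Real.exp (1 / 2)) := by ring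
          _ ≤ Real.exp (-3) * (Real.exp 1 * Real.exp (1 / 2)) := by gcongr
          _ = Real.exp (-3 + (1 + 1 / 2)) := by rw [Real.exp_add, Real.exp_add]
          _ ≤ Real.exp (-1) := Real.exp_le_exp.2 (by norm_num)
  have hsub : {a : Fin n → E | 3 * n * r < ∑ i, |f (a i)|} ⊆ {a | 1 ≤ ∏ i, g (a i)} := by
    intro a ha
    simp only [Set.mem_ofPred_eq, hg] at ha ⊢
    rw [← ENNReal.ofReal_prod_of_nonneg fun i _ => (Real.exp_pos _).le, ← Real.exp_sum,
      ← ENNReal.ofReal_one]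
    refine ENNReal.ofReal_le_ofReal (Real.one_le_exp ?_)
    rw [Finset.sum_sub_distrib, ← Finset.mul_sum]
    simp only [Finset.sum_const, Finset.card_univ, Fintype.card_fin, nsmul_eq_mul]
    rw [sub_nonneg, inv_mul_eq_div, le_div_iff₀ hr]
    linarith
  calc _ ≤ Measure.pi (fun _ : Fin n => μ) {a | 1 ≤ ∏ i, g (a i)} := measure_mono hsub
    _ ≤ ∫⁻ a, ∏ i, g (a i) ∂Measure.pi (fun _ : Fin n => μ) := by
      simpa using mul_meas_ge_le_lintegral (μ := Measure.pi (fun _ : Fin n => μ))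
        (f := fun a => ∏ i, g (a i)) (by fun_prop) 1
    _ = ∏ _i : Fin n, ∫⁻ a, g a ∂μ := lintegral_pi_prod_eq_prod _ fun _ => hgm
    _ ≤ ∏ _i : Fin n, ENNReal.ofReal (Real.exp (-1)) := Finset.prod_le_prod' fun _ _ => hgint
    _ = ENNReal.ofReal (Real.exp (-n)) := by
      rw [Finset.prod_const, Finset.card_univ, Fintype.card_fin,
        ← ENNReal.ofReal_pow (Real.exp_pos _).le, ← Real.exp_nat_mul]
      simp

lemma noiseLaw_sum_abs_gt_le (n : ℕ) {σ : ℝ} (hσ : 0 < σ) :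
    noiseLaw n σ {w | 3 * n * σ < ∑ i, |w i|} ≤ ENNReal.ofReal (Real.exp (-n)) := by
  refine measure_sum_abs_gt_le _ measurable_id hσ ?_ ?_ <;>
  · simp only [id]
    rw [lintegral_exp_mul_gaussianReal]
    refine le_of_eq ?_
    congr 2
    rw [Real.coe_toNNReal _ (sq_nonneg σ)]
    field_simp

lemma lintegral_exp_mul_dotProduct (d : ℕ) (x : EuclideanSpace ℝ (Fin d)) (t : ℝ) :
    ∫⁻ a, ENNReal.ofReal (Real.exp (t * (a ⬝ᵥ x.ofLp)))
      ∂Measure.pi (fun _ : Fin d => gaussianReal 0 1) =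
      ENNReal.ofReal (Real.exp (t ^ 2 * ‖x‖ ^ 2 / 2)) := by
  have h (a : Fin d → ℝ) : ENNReal.ofReal (Real.exp (t * (a ⬝ᵥ x.ofLp))) =
      ∏ j, ENNReal.ofReal (Real.exp (t * x j * a j)) := by
    rw [← ENNReal.ofReal_prod_of_nonneg fun i _ => (Real.exp_pos _).le, ← Real.exp_sum,
      dotProduct, Finset.mul_sum]
    simp only [mul_assoc, mul_comm (a _)]
  simp_rw [h]
  rw [lintegral_pi_prod_eq_prod _ (f := fun j b => ENNReal.ofReal (Real.exp (t * x j * b)))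
    fun j => by fun_prop]
  simp_rw [lintegral_exp_mul_gaussianReal]
  rw [← ENNReal.ofReal_prod_of_nonneg fun i _ => (Real.exp_pos _).le, ← Real.exp_sum,
    EuclideanSpace.norm_sq_eq, Finset.mul_sum, Finset.sum_div]
  simp [mul_pow]

lemma designLaw_sum_abs_gt_le (n : ℕ) {d : ℕ} (x : EuclideanSpace ℝ (Fin d)) {r : ℝ}
    (hr : 0 < r) (hx : ‖x‖ ≤ r) :
    designLaw n d {A | 3 * n * r < ∑ i, |(Matrix.of A *ᵥ x.ofLp) i|} ≤
      ENNReal.ofReal (Real.exp (-n)) := by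
  have hle : r⁻¹ ^ 2 * ‖x‖ ^ 2 / 2 ≤ 1 / 2 := by
    rw [← mul_pow, inv_mul_eq_div]
    have : ‖x‖ / r ≤ 1 := (div_le_one hr).2 hx
    have : (‖x‖ / r) ^ 2 ≤ 1 := pow_le_one₀ (by positivity) this
    linarith
  refine measure_sum_abs_gt_le _ (f := fun a : Fin d → ℝ => a ⬝ᵥ x.ofLp)
    (by unfold dotProduct; fun_prop) hr ?_ ?_
  · rw [lintegral_exp_mul_dotProduct]
    exact ENNReal.ofReal_le_ofReal (Real.exp_le_exp.2 hle)
  · rw [lintegral_exp_mul_dotProduct, neg_sq]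
    exact ENNReal.ofReal_le_ofReal (Real.exp_le_exp.2 hle)

/-! ### Confusable permutations -/

lemma card_filter_lt_abs_mul_le {ι : Type*} [Fintype ι] (f : ι → ℝ) (r : ℝ) :
    ((Finset.univ.filter fun i => r < |f i|).card : ℝ) * r ≤ ∑ i, |f i| := by
  calc ((Finset.univ.filter fun i => r < |f i|).card : ℝ) * r
      = ∑ i ∈ Finset.univ.filter fun i => r < |f i|, r := by simp
    _ ≤ ∑ i ∈ Finset.univ.filter fun i => r < |f i|, |f i| :=
      Finset.sum_le_sum fun i hi => (Finset.mem_filter.1 hi).2.le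
    _ ≤ ∑ i, |f i| :=
      Finset.sum_le_sum_of_subset_of_nonneg (Finset.filter_subset _ _) fun _ _ _ => abs_nonneg _

/-- Half of the indices are such that `z i` and `w i` have at most four times their admitted mean
size. -/
lemma card_abs_le_ge {n : ℕ} (hn : 1 ≤ n) {σ : ℝ} (hσ : 0 < σ) {z w : Fin n → ℝ}
    (hz : ∑ i, |z i| ≤ 3 * n * (n * σ)) (hw : ∑ i, |w i| ≤ 3 * n * σ) :
    (n : ℝ) / 2 ≤
      (Finset.univ.filter fun i => |z i| ≤ 12 * (n * σ) ∧ |w i| ≤ 12 * σ).card := by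
  have hn0 : (0 : ℝ) < n := by exact_mod_cast hn
  have h1 := (card_filter_lt_abs_mul_le z (12 * (n * σ))).trans hz
  have h2 := (card_filter_lt_abs_mul_le w (12 * σ)).trans hw
  set a := (Finset.univ.filter fun i => 12 * (n * σ) < |z i|) with ha
  set b := (Finset.univ.filter fun i => 12 * σ < |w i|) with hb
  set G := (Finset.univ.filter fun i => |z i| ≤ 12 * (n * σ) ∧ |w i| ≤ 12 * σ) with hG
  have h1' : (a.card : ℝ) ≤ n / 4 := by
    have : (0 : ℝ) < 12 * (n * σ) := by positivity
    refine le_of_mul_le_mul_right (h1.trans (le_of_eq ?_)) this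
    ring
  have h2' : (b.card : ℝ) ≤ n / 4 := by
    have : (0 : ℝ) < 12 * σ := by positivity
    refine le_of_mul_le_mul_right (h2.trans (le_of_eq ?_)) this
    ring
  have hcover : (Finset.univ : Finset (Fin n)) ⊆ G ∪ (a ∪ b) := by
    intro i _
    simp only [ha, hb, hG, Finset.mem_union, Finset.mem_filter, Finset.mem_univ, true_and]
    by_cases h : |z i| ≤ 12 * (n * σ) <;> by_cases h' : |w i| ≤ 12 * σ <;>
      simp_all
  have hcard : n ≤ G.card + (a.card + b.card) := by
    calc n = (Finset.univ : Finset (Fin n)).card := by simp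
      _ ≤ (G ∪ (a ∪ b)).card := Finset.card_le_card hcover
      _ ≤ G.card + (a ∪ b).card := Finset.card_union_le _ _
      _ ≤ _ := by gcongr; exact Finset.card_union_le _ _
  have : (n : ℝ) ≤ G.card + (a.card + b.card) := by exact_mod_cast hcard
  linarith

/-- A lower bound for the likelihood ratio of two hypotheses that differ by exchanging two signal
values at distance at most `96 σ`, when the noise at both indices is at most `12 σ`. With signal
difference `g` and noises `x`, `y`, the exponent `-(2 g ^ 2 + 2 g (x - y)) / (2 σ ^ 2)` of the ratio
is at least `-(96 ^ 2 + 96 * 24) = -11520`. -/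
noncomputable def likelihoodRatioBound : ℝ := Real.exp (-11520)

lemma likelihoodRatioBound_pos : 0 < likelihoodRatioBound := Real.exp_pos _

lemma gaussianPDF_mul_le_of_abs_le {σ : ℝ} (hσ : 0 < σ) {x y g : ℝ}
    (hx : |x| ≤ 12 * σ) (hy : |y| ≤ 12 * σ) (hg : |g| ≤ 96 * σ) :
    ENNReal.ofReal likelihoodRatioBound *
        (gaussianPDF 0 (Real.toNNReal (σ ^ 2)) x * gaussianPDF 0 (Real.toNNReal (σ ^ 2)) y) ≤
      gaussianPDF 0 (Real.toNNReal (σ ^ 2)) (x + g) *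
        gaussianPDF 0 (Real.toNNReal (σ ^ 2)) (y - g) := by
  have hL := likelihoodRatioBound_pos
  simp only [gaussianPDF]
  rw [← ENNReal.ofReal_mul (gaussianPDFReal_nonneg _ _ _),
    ← ENNReal.ofReal_mul (gaussianPDFReal_nonneg _ _ _), ← ENNReal.ofReal_mul hL.le]
  refine ENNReal.ofReal_le_ofReal ?_
  simp only [gaussianPDFReal, likelihoodRatioBound, Real.coe_toNNReal _ (sq_nonneg σ), sub_zero]
  set C := (√(2 * Real.pi * σ ^ 2))⁻¹ with hC
  have hexp : Real.exp (-11520) * (Real.exp (-x ^ 2 / (2 * σ ^ 2)) *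
      Real.exp (-y ^ 2 / (2 * σ ^ 2))) ≤
      Real.exp (-(x + g) ^ 2 / (2 * σ ^ 2)) * Real.exp (-(y - g) ^ 2 / (2 * σ ^ 2)) := by
    rw [← Real.exp_add, ← Real.exp_add, ← Real.exp_add, Real.exp_le_exp, ← add_div, ← add_div,
      ← sub_nonneg]
    have hs : 0 < 2 * σ ^ 2 := by positivity
    have hxy : |x - y| ≤ 24 * σ := (abs_sub x y).trans (by linarith)
    have h1 : |g * (x - y)| ≤ 96 * σ * (24 * σ) := by
      rw [abs_mul]; gcongr
    have h2 : g ^ 2 ≤ (96 * σ) ^ 2 := sq_le_sq.2 (by rwa [abs_of_pos (by positivity : 0 < 96 * σ)])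
    have h3 := (abs_le.1 h1).2
    have : (-(x + g) ^ 2 + -(y - g) ^ 2) / (2 * σ ^ 2) -
        (-11520 + (-x ^ 2 + -y ^ 2) / (2 * σ ^ 2)) =
        (11520 * (2 * σ ^ 2) - 2 * g ^ 2 - 2 * (g * (x - y))) / (2 * σ ^ 2) := by
      field_simp
      ring
    rw [this]
    apply div_nonneg _ hs.le
    nlinarith
  calc _ = C * C * (Real.exp (-11520) * (Real.exp (-x ^ 2 / (2 * σ ^ 2)) *
      Real.exp (-y ^ 2 / (2 * σ ^ 2)))) := by ring
    _ ≤ C * C * _ := mul_le_mul_of_nonneg_left hexp (mul_self_nonneg C)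
    _ = _ := by ring

/-- For typical signal values `z` and noise `w`, the likelihoods of all permutations, given the
observation `z + w`, add up to exponentially many times the likelihood of the true one. Of the at
least `n / 2` indices with `|z i| ≤ 12 n σ` and `|w i| ≤ 12 σ`, those with equal `⌊z i / (96 σ)⌋`
have signal values at distance at most `96 σ`, and there are at most `n / 4 + 2` values of this
floor. -/
lemma likelihood_le_sum_likelihood {n : ℕ} (hn : 1 ≤ n) {σ : ℝ} (hσ : 0 < σ) {z w : Fin n → ℝ}
    (hz : ∑ i, |z i| ≤ 3 * n * (n * σ)) (hw : ∑ i, |w i| ≤ 3 * n * σ) :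
    (1 + ENNReal.ofReal likelihoodRatioBound) ^ (n / 8 - 2) *
        ∏ i, gaussianPDF 0 (Real.toNNReal (σ ^ 2)) (w i) ≤
      ∑ h : Equiv.Perm (Fin n),
        ∏ i, gaussianPDF 0 (Real.toNNReal (σ ^ 2)) (z i + w i - z (h i)) := by
  set p := gaussianPDF 0 (Real.toNNReal (σ ^ 2)) with hp
  set G := (Finset.univ.filter fun i => |z i| ≤ 12 * (n * σ) ∧ |w i| ≤ 12 * σ) with hG
  have hGn : (n : ℝ) / 2 ≤ G.card := card_abs_le_ge hn hσ hz hw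
  set t := Finset.Icc ⌊-(n / 8 : ℝ)⌋ ⌊(n / 8 : ℝ)⌋ with ht
  have htc : (t.card : ℝ) ≤ n / 4 + 2 := by
    have h1 := Int.floor_le (n / 8 : ℝ)
    have h2 := Int.lt_floor_add_one (-(n / 8 : ℝ))
    have h3 : ⌊-(n / 8 : ℝ)⌋ ≤ ⌊(n / 8 : ℝ)⌋ + 1 := by
      have : ⌊-(n / 8 : ℝ)⌋ ≤ ⌊(n / 8 : ℝ)⌋ := Int.floor_mono (by
        have : (0 : ℝ) ≤ n / 8 := by positivity
        linarith)
      omega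
    have h4 : (t.card : ℤ) = ⌊(n / 8 : ℝ)⌋ + 1 - ⌊-(n / 8 : ℝ)⌋ := by
      rw [ht]; exact Int.card_Icc_of_le _ _ h3
    have h5 : (t.card : ℝ) = ⌊(n / 8 : ℝ)⌋ + 1 - ⌊-(n / 8 : ℝ)⌋ := by exact_mod_cast h4
    rw [h5]
    linarith
  have hk : n / 8 - 2 ≤ (G.card - t.card) / 2 := by
    rw [Nat.le_div_iff_mul_le (by norm_num)]
    rcases Nat.lt_or_ge (n / 8) 2 with h | h
    · omega
    · have h8 : ((n / 8 : ℕ) : ℝ) ≤ n / 8 := Nat.cast_div_le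
      have : (((n / 8 - 2) * 2 + t.card : ℕ) : ℝ) ≤ G.card := by
        push_cast [Nat.cast_sub h]
        linarith
      have : (n / 8 - 2) * 2 + t.card ≤ G.card := by exact_mod_cast this
      omega
  obtain ⟨S, -, hS⟩ := exists_perms_weight_ge (fun i j => p (z i + w i - z j))
    (ENNReal.ofReal likelihoodRatioBound) (fun i => ⌊z i / (96 * σ)⌋) t G
    (by
      intro i hi
      have hi := abs_le.1 (Finset.mem_filter.1 hi).2.1
      rw [ht, Finset.mem_Icc]
      refine ⟨Int.floor_mono ?_, Int.floor_mono ?_⟩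
      · rw [le_div_iff₀ (by positivity)]
        linarith
      · rw [div_le_iff₀ (by positivity)]
        linarith)
    (by
      intro a ha b hb _ hab
      have hd := Int.abs_sub_lt_one_of_floor_eq_floor hab
      rw [← sub_div, abs_div, abs_of_pos (by positivity : 0 < 96 * σ),
        div_lt_one (by positivity)] at hd
      have := gaussianPDF_mul_le_of_abs_le hσ (Finset.mem_filter.1 ha).2.2
        (Finset.mem_filter.1 hb).2.2 hd.le
      rw [← hp] at this
      convert this using 3 <;> ring_nf)
  simp only [add_sub_cancel_left] at hS
  calc _ ≤ (1 + ENNReal.ofReal likelihoodRatioBound) ^ ((G.card - t.card) / 2) * ∏ i, p (w i) := by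
        gcongr
        exact le_self_add
    _ ≤ _ := hS
    _ ≤ _ := Finset.sum_le_sum_of_subset (Finset.subset_univ S)

/-! ### The probability of success -/

/-- For a fixed design with signal values `z`, the estimators `f` that see `y = z ∘ π + w` find `π`
only with exponentially small probability on average over `π`. The event of success is charged to
the total likelihood of all permutations, so that the sum over `π` is at most that of the total
masses of the laws of `z ∘ π + w`, which is `n !`. -/
lemma sum_noiseLaw_success_le {n : ℕ} (hn : 1 ≤ n) {σ : ℝ} (hσ : 0 < σ) {z : Fin n → ℝ}
    (hz : ∑ i, |z i| ≤ 3 * n * (n * σ)) {f : (Fin n → ℝ) → Equiv.Perm (Fin n)}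
    (hf : ∀ π, MeasurableSet (f ⁻¹' {π})) :
    (1 + ENNReal.ofReal likelihoodRatioBound) ^ (n / 8 - 2) *
        ∑ π : Equiv.Perm (Fin n), noiseLaw n σ
          {w | f (z ∘ π + w) = π ∧ ∑ i, |w i| ≤ 3 * n * σ} ≤ n.factorial := by
  set k : ℝ≥0∞ := (1 + ENNReal.ofReal likelihoodRatioBound) ^ (n / 8 - 2) with hk
  set q : (Fin n → ℝ) → ℝ≥0∞ := fun w => ∏ i, gaussianPDF 0 (Real.toNNReal (σ ^ 2)) (w i) with hq
  have hqm : Measurable q :=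
    Finset.measurable_prod _ fun i _ => (measurable_gaussianPDF _ _).comp (measurable_pi_apply i)
  have hlaw : noiseLaw n σ = volume.withDensity q := noiseLaw_eq_withDensity n hσ
  have hone : ∫⁻ w, q w = 1 := by
    have h : noiseLaw n σ Set.univ = 1 := by
      have : IsProbabilityMeasure (noiseLaw n σ) := by unfold noiseLaw; infer_instance
      exact measure_univ
    rwa [hlaw, withDensity_apply _ MeasurableSet.univ, Measure.restrict_univ] at h
  set Q : (Fin n → ℝ) → ℝ≥0∞ := fun y => ∑ h : Equiv.Perm (Fin n), q (y - z ∘ h) with hQ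
  have hQm : Measurable Q := by fun_prop
  have hterm (π : Equiv.Perm (Fin n)) :
      k * noiseLaw n σ {w | f (z ∘ π + w) = π ∧ ∑ i, |w i| ≤ 3 * n * σ} ≤
        ∫⁻ y in f ⁻¹' {π}, Q y := by
    have hms : MeasurableSet {w : Fin n → ℝ | f (z ∘ π + w) = π ∧ ∑ i, |w i| ≤ 3 * n * σ} := by
      have hs : Measurable fun w : Fin n → ℝ => ∑ i, |w i| := by fun_prop
      refine MeasurableSet.inter ?_ (measurableSet_le hs measurable_const)
      exact (hf π).preimage (by fun_prop : Measurable fun w => z ∘ π + w)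
    rw [hlaw, withDensity_apply _ hms, ← lintegral_const_mul _ hqm, ← lintegral_indicator hms,
      ← lintegral_indicator (hf π),
      ← lintegral_add_left_eq_self ((f ⁻¹' {π}).indicator Q) (z ∘ π)]
    refine lintegral_mono fun w => ?_
    -- On the event of success, the integrand is the likelihood of `π` at `y = z ∘ π + w`, shifted
    -- by `z ∘ π`; the bound compares it with the likelihoods of the permutations `π * h`.
    by_cases hw : f (z ∘ π + w) = π ∧ ∑ i, |w i| ≤ 3 * n * σ
    · rw [Set.indicator_of_mem (by exact hw), Set.indicator_of_mem (by exact hw.1)]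
      have hzπ : ∑ i, |(z ∘ π) i| ≤ 3 * n * (n * σ) := by
        simpa only [Function.comp_apply, Equiv.sum_comp π fun i => |z i|] using hz
      refine (likelihood_le_sum_likelihood hn hσ hzπ hw.2).trans_eq ?_
      exact Fintype.sum_equiv (Equiv.mulLeft π) _ _ fun h => by simp [hq]
    · rw [Set.indicator_of_notMem (by exact hw)]
      exact zero_le
  calc k * ∑ π : Equiv.Perm (Fin n), noiseLaw n σ
          {w | f (z ∘ π + w) = π ∧ ∑ i, |w i| ≤ 3 * n * σ}
      ≤ ∑ π : Equiv.Perm (Fin n), ∫⁻ y in f ⁻¹' {π}, Q y := by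
        rw [Finset.mul_sum]
        exact Finset.sum_le_sum fun π _ => hterm π
    _ = ∫⁻ y in ⋃ π, f ⁻¹' {π}, Q y := by
        rw [lintegral_iUnion hf (fun π π' h => ?_), tsum_fintype]
        exact Set.disjoint_left.2 fun y hy hy' => h (hy.symm.trans hy')
    _ ≤ ∫⁻ y, Q y := setLIntegral_le_lintegral _ _
    _ = ∑ _h : Equiv.Perm (Fin n), 1 := by
        rw [lintegral_finsetSum _ fun h _ => by fun_prop]
        refine Finset.sum_congr rfl fun h _ => ?_
        rw [lintegral_sub_right_eq_self q, hone]
    _ = n.factorial := by simp [Fintype.card_perm]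

lemma observation_eq {n d : ℕ} (x : EuclideanSpace ℝ (Fin d)) (π : Equiv.Perm (Fin n))
    (A : Fin n → Fin d → ℝ) (w : Fin n → ℝ) :
    observation x π A w = (Matrix.of A *ᵥ x.ofLp) ∘ π + w := by
  rw [observation, Matrix.permMatrix_mulVec]

lemma measurable_signal (n : ℕ) {d : ℕ} (x : EuclideanSpace ℝ (Fin d)) :
    Measurable fun A : Fin n → Fin d → ℝ => Matrix.of A *ᵥ x.ofLp := by
  refine measurable_pi_lambda _ fun i => ?_
  simp only [Matrix.mulVec, dotProduct, Matrix.of_apply]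
  fun_prop

lemma measurableSet_success {n d : ℕ} (x : EuclideanSpace ℝ (Fin d))
    {est : (Fin n → ℝ) × (Fin n → Fin d → ℝ) → Equiv.Perm (Fin n)} (hest : IsEstimator est)
    (π : Equiv.Perm (Fin n)) :
    MeasurableSet {p : (Fin n → Fin d → ℝ) × (Fin n → ℝ) |
      est (observation x π p.1 p.2, p.1) = π} := by
  refine (hest π).preimage (f := fun p : (Fin n → Fin d → ℝ) × (Fin n → ℝ) =>
    (observation x π p.1 p.2, p.1)) ?_
  simp only [observation_eq]
  have hz : Measurable fun p : (Fin n → Fin d → ℝ) × (Fin n → ℝ) =>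
      (Matrix.of p.1 *ᵥ x.ofLp) := (measurable_signal n x).comp measurable_fst
  have : Measurable fun p : (Fin n → Fin d → ℝ) × (Fin n → ℝ) =>
      (Matrix.of p.1 *ᵥ x.ofLp) ∘ π :=
    measurable_pi_lambda _ fun i => (measurable_pi_apply (π i)).comp hz
  fun_prop

instance (n d : ℕ) : IsProbabilityMeasure (designLaw n d) := by
  unfold designLaw; infer_instance

instance (n : ℕ) (σ : ℝ) : IsProbabilityMeasure (noiseLaw n σ) := by
  unfold noiseLaw; infer_instance

/-- The probabilities of success, summed over the true permutation: typical designs and noise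
contribute the second term, and the exceptional ones the first. -/
lemma sum_success_le {n d : ℕ} (hn : 1 ≤ n) (x : EuclideanSpace ℝ (Fin d)) {σ : ℝ} (hσ : 0 < σ)
    (hx : ‖x‖ ≤ n * σ) {est : (Fin n → ℝ) × (Fin n → Fin d → ℝ) → Equiv.Perm (Fin n)}
    (hest : IsEstimator est) :
    ∑ π : Equiv.Perm (Fin n), ((designLaw n d).prod (noiseLaw n σ))
        {p | est (observation x π p.1 p.2, p.1) = π} ≤
      n.factorial * (2 * ENNReal.ofReal (Real.exp (-n))) +
        ((1 + ENNReal.ofReal likelihoodRatioBound) ^ (n / 8 - 2))⁻¹ * n.factorial := by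
  set k : ℝ≥0∞ := (1 + ENNReal.ofReal likelihoodRatioBound) ^ (n / 8 - 2) with hk
  have hk0 : k ≠ 0 := pow_ne_zero _ (by simp)
  have hkt : k ≠ ∞ := ENNReal.pow_ne_top (by simp)
  have hr : 0 < n * σ := mul_pos (by exact_mod_cast hn) hσ
  set μ := (designLaw n d).prod (noiseLaw n σ) with hμ
  set BA : Set (Fin n → Fin d → ℝ) :=
    {A | 3 * n * (n * σ) < ∑ i, |(Matrix.of A *ᵥ x.ofLp) i|} with hBA
  set Bw : Set (Fin n → ℝ) := {w | 3 * n * σ < ∑ i, |w i|} with hBw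
  have hBAm : MeasurableSet BA := by
    have (i : Fin n) := (measurable_pi_apply i).comp (measurable_signal n x)
    exact measurableSet_lt measurable_const
      (Finset.measurable_sum _ fun i _ => continuous_abs.measurable.comp (this i))
  have hBwm : MeasurableSet Bw := by
    have hs : Measurable fun w : Fin n → ℝ => ∑ i, |w i| := by fun_prop
    exact measurableSet_lt measurable_const hs
  set T : Equiv.Perm (Fin n) → Set ((Fin n → Fin d → ℝ) × (Fin n → ℝ)) := fun π =>
    {p | est (observation x π p.1 p.2, p.1) = π} ∩ (BAᶜ ×ˢ Bwᶜ) with hT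
  have hTm (π) : MeasurableSet (T π) :=
    (measurableSet_success x hest π).inter (hBAm.compl.prod hBwm.compl)
  have hbad (π : Equiv.Perm (Fin n)) : μ {p | est (observation x π p.1 p.2, p.1) = π} ≤
      2 * ENNReal.ofReal (Real.exp (-n)) + μ (T π) := by
    have hcover : {p | est (observation x π p.1 p.2, p.1) = π} ⊆
        ((BA ×ˢ Set.univ) ∪ (Set.univ ×ˢ Bw)) ∪ T π := by
      intro p hp
      by_cases h1 : p.1 ∈ BA
      · exact Or.inl (Or.inl ⟨h1, trivial⟩)
      by_cases h2 : p.2 ∈ Bw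
      · exact Or.inl (Or.inr ⟨trivial, h2⟩)
      exact Or.inr ⟨hp, h1, h2⟩
    refine (measure_mono hcover).trans ((measure_union_le _ _).trans ?_)
    gcongr
    refine (measure_union_le _ _).trans ?_
    rw [hμ, Measure.prod_prod, Measure.prod_prod, measure_univ, measure_univ, mul_one, one_mul,
      two_mul]
    exact add_le_add (designLaw_sum_abs_gt_le n x hr hx) (noiseLaw_sum_abs_gt_le n hσ)
  have hgood : ∑ π, μ (T π) ≤ k⁻¹ * n.factorial := by
    simp_rw [hμ, Measure.prod_apply (hTm _)]
    rw [← lintegral_finsetSum _ fun π _ => measurable_measure_prodMk_left (hTm π)]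
    calc _ ≤ ∫⁻ _A, k⁻¹ * n.factorial ∂designLaw n d := ?_
      _ = k⁻¹ * n.factorial := by simp
    refine lintegral_mono fun A => ?_
    -- For an exceptional design the event is empty, since `T π` excludes such designs.
    by_cases hA : A ∈ BA
    · have hempty (π : Equiv.Perm (Fin n)) : Prod.mk A ⁻¹' T π = ∅ :=
        Set.eq_empty_of_forall_notMem fun w hw => hw.2.1 hA
      simp [hempty]
    · rw [← ENNReal.div_eq_inv_mul, ENNReal.le_div_iff_mul_le (Or.inl hk0) (Or.inl hkt), mul_comm]
      have hf (π : Equiv.Perm (Fin n)) : MeasurableSet ((fun y => est (y, A)) ⁻¹' {π}) :=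
        (hest π).preimage (measurable_id.prodMk measurable_const)
      refine le_trans ?_ (sum_noiseLaw_success_le hn hσ (not_lt.1 hA) hf)
      gcongr with π
      intro w hw
      refine ⟨?_, not_lt.1 hw.2.2⟩
      have := hw.1
      simpa [observation_eq] using this
  calc _ ≤ ∑ π : Equiv.Perm (Fin n), (2 * ENNReal.ofReal (Real.exp (-n)) + μ (T π)) :=
        Finset.sum_le_sum fun π _ => hbad π
    _ = n.factorial * (2 * ENNReal.ofReal (Real.exp (-n))) + ∑ π, μ (T π) := by
        rw [Finset.sum_add_distrib]
        simp [Fintype.card_perm]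
    _ ≤ _ := by gcongr

lemma one_sub_le_averageErrorProb {n d : ℕ} (hn : 1 ≤ n) (x : EuclideanSpace ℝ (Fin d)) {σ : ℝ}
    (hσ : 0 < σ) (hx : ‖x‖ ≤ n * σ)
    {est : (Fin n → ℝ) × (Fin n → Fin d → ℝ) → Equiv.Perm (Fin n)} (hest : IsEstimator est) :
    1 - (2 * Real.exp (-n) + ((1 + likelihoodRatioBound) ^ (n / 8 - 2))⁻¹) ≤
      averageErrorProb x σ est := by
  have hL := likelihoodRatioBound_pos
  have hfac : (0 : ℝ) < n.factorial := by exact_mod_cast n.factorial_pos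
  have herr (π : Equiv.Perm (Fin n)) : errorProb x σ est π =
      1 - ((designLaw n d).prod (noiseLaw n σ)).real
        {p | est (observation x π p.1 p.2, p.1) = π} :=
    probReal_compl_eq_one_sub (measurableSet_success x hest π)
  have hsum : ∑ π : Equiv.Perm (Fin n), ((designLaw n d).prod (noiseLaw n σ)).real
        {p | est (observation x π p.1 p.2, p.1) = π} ≤
      n.factorial * (2 * Real.exp (-n) + ((1 + likelihoodRatioBound) ^ (n / 8 - 2))⁻¹) := by
    simp only [Measure.real]
    rw [← ENNReal.toReal_sum fun _ _ => measure_ne_top _ _]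
    refine ENNReal.toReal_le_of_le_ofReal (by positivity) ((sum_success_le hn x hσ hx hest).trans
      (le_of_eq ?_))
    rw [mul_add, ENNReal.ofReal_add (by positivity) (by positivity), ENNReal.ofReal_mul hfac.le,
      ENNReal.ofReal_mul hfac.le, ENNReal.ofReal_mul (by norm_num),
      ENNReal.ofReal_inv_of_pos (by positivity), ENNReal.ofReal_pow (by positivity),
      ENNReal.ofReal_add zero_le_one hL.le, ENNReal.ofReal_natCast, ENNReal.ofReal_one,
      mul_comm ((_ : ℝ≥0∞)⁻¹)]
    simp
  rw [averageErrorProb, le_div_iff₀ hfac]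
  simp_rw [herr]
  rw [Finset.sum_sub_distrib]
  simp only [Finset.sum_const, Finset.card_univ, Fintype.card_perm, Fintype.card_fin,
    nsmul_eq_mul, mul_one]
  linarith

lemma exists_averageErrorProb_le {n d : ℕ} (x : EuclideanSpace ℝ (Fin d)) (σ : ℝ)
    (est : (Fin n → ℝ) × (Fin n → Fin d → ℝ) → Equiv.Perm (Fin n)) :
    ∃ π, averageErrorProb x σ est ≤ errorProb x σ est π := by
  have hfac : (0 : ℝ) < n.factorial := by exact_mod_cast n.factorial_pos
  obtain ⟨π, -, hπ⟩ := Finset.exists_le_of_sum_le (s := Finset.univ)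
    (f := fun _ : Equiv.Perm (Fin n) => averageErrorProb x σ est) (g := errorProb x σ est)
    Finset.univ_nonempty (by
      simp only [Finset.sum_const, Finset.card_univ, Fintype.card_perm, Fintype.card_fin,
        nsmul_eq_mul]
      rw [averageErrorProb, mul_div_cancel₀ _ hfac.ne'])
  exact ⟨π, hπ⟩

/-! ### The signal-to-noise condition -/

/-- If `2 + log (1 + SNR) ≤ (2 - δ) log n`, then the signal is at most `n` times as large as the
noise level. -/
lemma norm_le_of_snr_condition {E : Type*} [SeminormedAddCommGroup E] {n : ℕ} {x : E} {σ δ : ℝ}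
    (hσ : 0 < σ) (hδ : 0 < δ)
    (h : 2 + Real.log (1 + ‖x‖ ^ 2 / σ ^ 2) ≤ (2 - δ) * Real.log n) :
    1 ≤ n ∧ ‖x‖ ≤ n * σ := by
  have hsnr : 0 ≤ ‖x‖ ^ 2 / σ ^ 2 := by positivity
  have hlog : 0 ≤ Real.log (1 + ‖x‖ ^ 2 / σ ^ 2) := Real.log_nonneg (by linarith)
  have hn : 1 ≤ n := by
    by_contra h0
    obtain rfl : n = 0 := by omega
    simp at h
    linarith
  have hn0 : (0 : ℝ) < n := by exact_mod_cast hn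
  have hlogn : 0 ≤ Real.log n := Real.log_natCast_nonneg n
  refine ⟨hn, ?_⟩
  have h1 : Real.log (1 + ‖x‖ ^ 2 / σ ^ 2) ≤ Real.log ((n : ℝ) ^ 2) := by
    rw [Real.log_pow]
    push_cast
    nlinarith
  have h2 : ‖x‖ ^ 2 / σ ^ 2 ≤ (n : ℝ) ^ 2 := by
    linarith [(Real.log_le_log_iff (by linarith) (by positivity)).1 h1]
  rw [div_le_iff₀ (by positivity), ← mul_pow] at h2
  exact le_of_sq_le_sq h2 (by positivity)

/-- The error bound in the form `c₃ exp (-c₄ n δ)`. The decay is exponential in `n` whatever `δ` is,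
and `δ < 2` only weakens it. The factor `(1 + L) ^ 3` absorbs the rounding in `n / 8 - 2`, which
is a natural number and is at least `n / 8 - 3` as a real number. -/
lemma error_bound_le_exp (n : ℕ) {L δ : ℝ} (hL : 0 < L) (hL1 : L ≤ 1) (hδ : 0 < δ) (hδ2 : δ < 2) :
    2 * Real.exp (-n) + ((1 + L) ^ (n / 8 - 2))⁻¹ ≤
      (2 + (1 + L) ^ 3) * Real.exp (-(Real.log (1 + L) / 16) * n * δ) := by
  set κ := Real.log (1 + L) with hκ
  have hκ0 : 0 < κ := Real.log_pos (by linarith)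
  have hκ1 : κ ≤ 1 := (Real.log_le_sub_one_of_pos (by linarith)).trans (by linarith)
  have hexp : Real.exp κ = 1 + L := Real.exp_log (by linarith)
  have hn0 : (0 : ℝ) ≤ n := Nat.cast_nonneg n
  have h1 : Real.exp (-n) ≤ Real.exp (-(κ / 16) * n * δ) := by
    refine Real.exp_le_exp.2 ?_
    have : κ * δ ≤ 16 := by nlinarith
    nlinarith
  have h2 : ((1 + L) ^ (n / 8 - 2))⁻¹ ≤ (1 + L) ^ 3 * Real.exp (-(κ / 16) * n * δ) := by
    rw [← hexp, ← Real.exp_nat_mul, ← Real.exp_nat_mul, ← Real.exp_neg, ← Real.exp_add]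
    refine Real.exp_le_exp.2 ?_
    have hm : (n : ℝ) / 8 - 3 ≤ (n / 8 - 2 : ℕ) := by
      have : n ≤ 8 * (n / 8 - 2) + 24 := by omega
      have : (n : ℝ) ≤ 8 * (n / 8 - 2 : ℕ) + 24 := by exact_mod_cast this
      linarith
    have h3 : κ * (n / 8 - 3) ≤ κ * (n / 8 - 2 : ℕ) := by gcongr
    have h4 : κ * n * δ ≤ κ * n * 2 := by gcongr
    push_cast
    nlinarith
  linarith

end UnknownPermutation

theorem theorem2 :
    ∃ c₃ c₄ : ℝ, 0 < c₃ ∧ 0 < c₄ ∧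
      ∀ (n d : ℕ) (x : EuclideanSpace ℝ (Fin d)) (σ : ℝ) (δ : ℝ),
        0 < σ → 0 < δ → δ < 2 →
        2 + Real.log (1 + ‖x‖ ^ 2 / σ ^ 2) ≤ (2 - δ) * Real.log n →
        ∀ est : (Fin n → ℝ) × (Fin n → Fin d → ℝ) → Equiv.Perm (Fin n),
          UnknownPermutation.IsEstimator est →
          1 - c₃ * Real.exp (-c₄ * n * δ) ≤ UnknownPermutation.averageErrorProb x σ est ∧
          ∃ π : Equiv.Perm (Fin n),
            1 - c₃ * Real.exp (-c₄ * n * δ) ≤ UnknownPermutation.errorProb x σ est π := by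
  have hL := UnknownPermutation.likelihoodRatioBound_pos
  have hL1 : UnknownPermutation.likelihoodRatioBound ≤ 1 := Real.exp_le_one_iff.2 (by norm_num)
  set L := UnknownPermutation.likelihoodRatioBound
  refine ⟨2 + (1 + L) ^ 3, Real.log (1 + L) / 16, by positivity,
    div_pos (Real.log_pos (by linarith)) (by norm_num), ?_⟩
  intro n d x σ δ hσ hδ hδ2 hsnr est hest
  obtain ⟨hn, hx⟩ := UnknownPermutation.norm_le_of_snr_condition hσ hδ hsnr
  have havg := UnknownPermutation.one_sub_le_averageErrorProb hn x hσ hx hest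
  have hbound := UnknownPermutation.error_bound_le_exp n hL hL1 hδ hδ2
  obtain ⟨π, hπ⟩ := UnknownPermutation.exists_averageErrorProb_le x σ est
  exact ⟨by linarith, π, by linarith⟩
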